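/- Let $G$ be a group generated by a finite set $S$ (every element of $G$ is the value $w_G$ of some word $w\in S^*$), with decidable word problem (the set $\{w\in S^* : w_G=1_G\}$ is decidable), and let $A$ be a finite alphabet. A shift is a subset $X\subseteq A^G$ that is closed in the product topology ($A$ being discrete) and invariant under $x\mapsto gx$, $(gx)(h)=x(g^{-1}h)$, for all $g\in G$. A subshift of $X$ is a shift contained in $X$, and $X$ is quasi-minimal if it has only finitely many distinct subshifts. A pattern is a map $p:F\to A$ with $F\subseteq G$ finite. The language $\mathcal L(X)$ is the set of all patterns $p:F\to A$ such that $x|_F=p$ for some $x\in X$, and $\mathcal L^c(X)$ is the set of all other patterns. For computations, a pattern $p:F\to A$ is described by a finite map $p':W\to A$, where $W\subset S^*$ is a finite set of words with $\{w_G:w\in W\}=F$ and $p'(w)=p(w_G)$ for all $w\in W$; a set of patterns is computably enumerable (c.e.) relative to an oracle $O\subseteq\mathbb N$ if the set of all descriptions of its elements is. The shift $X$ has strong computable type if for every oracle $O\subseteq\mathbb N$ such that $X$ is effectively closed relative to $O$ (that is, $\mathcal L^c(X)$ is c.e. relative to $O$), the language $\mathcal L(X)$ is computable relative to $O$ (that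 is, both $\mathcal L(X)$ and $\mathcal L^c(X)$ are c.e. relative to $O$). Proposition. Every quasi-minimal shift $X\subseteq A^G$ has strong computable type. -/

import Mathlib

open SymbolicDynamics.FullShift (MulSubshift)

noncomputable section

namespace GShift

/-! ### Computability relative to an oracle -/

/-- The characteristic function of `O ⊆ ℕ`, as a (total) function that machines may query. -/
def oracleFun (O : Set ℕ) : ℕ →. ℕ :=
  open scoped Classical in fun m => Part.some (if m ∈ O then 1 else 0)

/-- `I` is computably enumerable relative to the oracle `O`: some procedure with access to `O`
runs forever and lists exactly the elements of `I`. At stage `t` it outputs either one element of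
`I` (`f t = some a`) or nothing (`f t = none`), so `I` may be empty or finite. -/
def CEIn {α : Type*} [Primcodable α] (O : Set ℕ) (I : Set α) : Prop :=
  ∃ f : ℕ → Option α, ComputableIn {oracleFun O} f ∧ ∀ a, a ∈ I ↔ ∃ t, f t = some a

/-! ### Words in the generators -/

section Words

variable {G : Type*} [Group G] {n : ℕ}

/-- The group element `w_G` represented by a word `w` in the generators `s 0, …, s (n - 1)`. -/
def wordEval (s : Fin n → G) (w : List (Fin n)) : G := (w.map s).prod

/-- Every element of the group is the value of a word in the generators. -/
def IsGenerating (s : Fin n → G) : Prop := ∀ g : G, ∃ w : List (Fin n), wordEval s w = g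

/-- The set of words that represent the identity is decidable. -/
def DecidableWordProblem (s : Fin n → G) : Prop :=
  ComputablePred fun w : List (Fin n) => wordEval s w = 1

end Words

/-! ### Patterns, languages and their codes -/

/-- A pattern: a map `F → A` on a finite set `F ⊆ G`. -/
structure Pattern (G A : Type*) where
  support : Finset G
  val : support → A

/-- The language of a set of configurations: the patterns `p : F → A` with `x|_F = p`
for some `x ∈ X`. -/
def language {G A : Type*} (X : Set (G → A)) : Set (Pattern G A) :=
  {p | ∃ x ∈ X, ∀ g : p.support, x g = p.val g}

/-- Finite descriptions of patterns: the list of pairs (argument, value) of a finite partial map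
from words to letters, letters being given by their numbers. -/
abbrev Code (n k : ℕ) : Type := List (List (Fin n) × Fin k)

/-- The code `c` describes the pattern `p : F → A`: each pair `(w, a)` of `c` satisfies `w_G ∈ F`
and `p (w_G) = a`, and each element of `F` is the value of some word that is listed in `c`. -/
def Represents {G A : Type*} [Group G] {n k : ℕ} (s : Fin n → G) (e : A ≃ Fin k)
    (c : Code n k) (p : Pattern G A) : Prop :=
  (∀ wa ∈ c, ∃ h : wordEval s wa.1 ∈ p.support, p.val ⟨wordEval s wa.1, h⟩ = e.symm wa.2) ∧
    ∀ g ∈ p.support, ∃ wa ∈ c, wordEval s wa.1 = g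

/-- The codes of the patterns in `L`. -/
def codes {G A : Type*} [Group G] {n k : ℕ} (s : Fin n → G) (e : A ≃ Fin k)
    (L : Set (Pattern G A)) : Set (Code n k) :=
  {c | ∃ p ∈ L, Represents s e c p}

/-! ### Shifts

Mathlib's `MulSubshift A G` is the type of closed subsets of `G → A` that are invariant under
`x ↦ (h ↦ x (g * h))` for every `g`. Over a group this is invariance under
`x ↦ (h ↦ x (g⁻¹ * h))` for every `g`. -/

section Shifts

variable {G A : Type*} [Group G] [TopologicalSpace A] {n k : ℕ}

/-- `X` is effectively closed relative to `O`: its language is co-c.e. relative to `O`. -/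
def EffectivelyClosedIn (s : Fin n → G) (e : A ≃ Fin k) (O : Set ℕ) (X : MulSubshift A G) :
    Prop :=
  CEIn O (codes s e (language X.carrier)ᶜ)

/-- The language of `X` is computable relative to `O`: it is c.e. and co-c.e. relative to `O`. -/
def ComputableLanguageIn (s : Fin n → G) (e : A ≃ Fin k) (O : Set ℕ) (X : MulSubshift A G) :
    Prop :=
  CEIn O (codes s e (language X.carrier)) ∧ CEIn O (codes s e (language X.carrier)ᶜ)

/-- `X` has strong computable type: every oracle relative to which `X` is effectively closed
computes the language of `X`. -/
def StrongComputableType (s : Fin n → G) (e : A ≃ Fin k) (X : MulSubshift A G) : Prop :=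
  ∀ O : Set ℕ, EffectivelyClosedIn s e O X → ComputableLanguageIn s e O X

/-- `X` is quasi-minimal: it has only finitely many distinct subshifts. -/
def QuasiMinimal (X : MulSubshift A G) : Prop :=
  {Y : MulSubshift A G | Y.carrier ⊆ X.carrier}.Finite

end Shifts

end GShift

end

namespace GShift

open Encodable

/-! ### Relative computability -/

/-! A quasi-minimal `X` has finitely many proper subshifts, and each misses some pattern of `X`; fix
a finite list `Q` of such patterns (`QuasiMinimal.exists_testCodes`). Let `Y` be the subshift of
points of `X` in which `c` does not occur (`avoiding`). If `c` is in the language, `Y` is proper, so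
some `q ∈ Q` does not occur in `Y`: every point of `X` agreeing with `q` contains a translate of
`c`. Conversely, this property for one `q ∈ Q` puts `c` in the language, because `q` occurs in `X`.

The property says that the cylinder of `q` is covered by the cylinders of forbidden patterns, which
the oracle enumerates, and of translates of `c`. By compactness (`eventually_matches_of_cover`) a
cover is detected at a finite stage, so the property is semi-decidable.

The search runs over colourings of words instead of configurations. A colouring that gives two
letters to one group element is ruled out by `clashCodes`, which is where the word problem enters.
-/

theorem computableIn_nat_iff {β : Type*} [Primcodable β] {O : Set (ℕ →. ℕ)} {f : ℕ → β} :
    ComputableIn O f ↔ Nat.RecursiveIn O fun m => Part.some (encode (f m)) := by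
  simp [ComputableIn, RecursiveIn]

theorem recursiveIn_comp_pair {f g : ℕ → ℕ} {h : ℕ → ℕ → ℕ} {O : Set (ℕ →. ℕ)}
    (hh : Computable₂ h) (hf : Nat.RecursiveIn O fun m => Part.some (f m))
    (hg : Nat.RecursiveIn O fun m => Part.some (g m)) :
    Nat.RecursiveIn O fun m => Part.some (h (f m) (g m)) := by
  have hc : Computable fun p : ℕ => h p.unpair.1 p.unpair.2 :=
    hh.comp (Computable.fst.comp Computable.unpair) (Computable.snd.comp Computable.unpair)
  have hr : Nat.RecursiveIn O fun p : ℕ => Part.some (h p.unpair.1 p.unpair.2) :=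
    Nat.Partrec.recursiveIn (Partrec.nat_iff.1 hc)
  refine (hr.comp (hf.pair hg)).of_eq fun m => ?_
  simp [Seq.seq]

theorem Computable.comp_computableIn {β γ : Type*} [Primcodable β] [Primcodable γ]
    {O : Set (ℕ →. ℕ)} {F : ℕ → β → γ} {f : ℕ → β} (hF : Computable₂ F)
    (hf : ComputableIn O f) : ComputableIn O fun m => F m (f m) := by
  rw [computableIn_nat_iff] at hf ⊢
  have hF' : Computable₂ fun m i : ℕ =>
      ((decode i : Option β).map fun b => encode (F m b)).getD 0 := by
    refine Computable.option_getD (Computable.option_map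
      (Computable.decode.comp Computable.snd) ?_) (Computable.const 0)
    exact Computable.encode.comp (hF.comp (Computable.fst.comp Computable.fst) Computable.snd)
  refine (recursiveIn_comp_pair hF' (f := id)
    (Nat.Partrec.recursiveIn (Partrec.nat_iff.1 Computable.id)) hf).of_eq fun m => ?_
  simp

/-- Lets a stage of the search use all outputs of the oracle enumeration produced so far. -/
theorem ComputableIn.map_range {β : Type*} [Primcodable β] {O : Set (ℕ →. ℕ)} {f : ℕ → β}
    (hf : ComputableIn O f) : ComputableIn O fun m => (List.range m).map f := by
  rw [computableIn_nat_iff] at hf ⊢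
  have hid : Nat.RecursiveIn O fun m => Part.some (id m) :=
    Nat.Partrec.recursiveIn (Partrec.nat_iff.1 Computable.id)
  have hstep : Computable₂ fun i b : ℕ => encode
      (((decode i : Option (List β)).getD []) ++ (decode b : Option β).toList) :=
    (Primrec.encode.comp (Primrec.list_append.comp
      (Primrec.option_getD.comp (Primrec.decode.comp Primrec.fst) (Primrec.const []))
      (Primrec.optionToList.comp (Primrec.decode.comp Primrec.snd)))).to_comp
  have hi : Nat.RecursiveIn O fun p => Part.some ((Nat.unpair (Nat.unpair p).2).2) :=
    Nat.Partrec.recursiveIn (Partrec.nat_iff.1 (Computable.snd.comp (Computable.unpair.comp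
      (Computable.snd.comp Computable.unpair))))
  have hy : Nat.RecursiveIn O fun p => Part.some ((Nat.unpair (Nat.unpair p).2).1) :=
    Nat.Partrec.recursiveIn (Partrec.nat_iff.1 (Computable.fst.comp (Computable.unpair.comp
      (Computable.snd.comp Computable.unpair))))
  have hfy : Nat.RecursiveIn O fun p => Part.some (encode (f (Nat.unpair (Nat.unpair p).2).1)) :=
    (hf.comp hy).of_eq fun p => by simp
  have hs := recursiveIn_comp_pair hstep hi hfy
  have h0 : Nat.RecursiveIn O fun _ => Part.some (encode ([] : List β)) :=
    Nat.Partrec.recursiveIn (Partrec.nat_iff.1 (Computable.const _))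
  -- The recursion scheme expects a parameter; 0 is a dummy.
  have hp : Nat.RecursiveIn O fun m => Part.some (Nat.pair 0 m) :=
    recursiveIn_comp_pair (h := fun _ b => Nat.pair 0 b) (f := id) (g := id)
      (Primrec₂.natPair.comp (Primrec.const 0) Primrec.snd).to_comp hid hid
  refine ((h0.prec hs).comp hp).of_eq fun m => ?_
  simp only [Part.bind_eq_bind, Part.bind_some, Nat.unpair_pair]
  induction m with
  | zero => simp
  | succ m ih =>
    simp only [] at ih ⊢
    rw [ih]
    simp [List.range_succ]

/-! ### Finite checks on colourings of words -/

section Checks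

variable {n k : ℕ}

/-- The list `l`, seen as a colouring of the words with number less than `l.length`,
agrees with `c`. -/
def Matches (l : List (Fin k)) (c : Code n k) : Prop := ∀ wa ∈ c, l[encode wa.1]? = some wa.2

theorem primrecRel_matches : PrimrecRel (Matches (n := n) (k := k)) := by
  have h : PrimrecRel fun (wa : List (Fin n) × Fin k) (l : List (Fin k)) =>
      l[encode wa.1]? = some wa.2 :=
    Primrec.eq.comp
      (Primrec.list_getElem?.comp Primrec.snd
        (Primrec.encode.comp (Primrec.fst.comp Primrec.fst)))
      (Primrec.option_some.comp (Primrec.snd.comp Primrec.fst))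
  exact h.forall_mem_list.comp Primrec.snd Primrec.fst

/-- All lists of length `t` of letters. -/
def colourings (k : ℕ) (t : ℕ) : List (List (Fin k)) :=
  t.rec [[]] fun _ L => L.flatMap fun l => (List.finRange k).map fun a => a :: l

theorem mem_colourings {t : ℕ} {l : List (Fin k)} : l ∈ colourings k t ↔ l.length = t := by
  induction t generalizing l with
  | zero => simp [colourings]
  | succ t ih =>
    change l ∈ (colourings k t).flatMap _ ↔ _
    cases l with
    | nil => simp
    | cons a l => simp [ih]

theorem primrec_colourings : Primrec (colourings k) := by
  have h : Primrec₂ fun (_ : ℕ) (p : ℕ × List (List (Fin k))) =>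
      p.2.flatMap fun l => (List.finRange k).map fun a => a :: l := by
    refine Primrec.list_flatMap (Primrec.snd.comp Primrec.snd) ?_
    refine Primrec.list_map (Primrec.const _) ?_
    exact Primrec.list_cons.comp Primrec.snd (Primrec.snd.comp Primrec.fst)
  exact (Primrec.nat_rec (Primrec.const [[]]) h).comp Primrec.id Primrec.id

/-- The code `c` with all words multiplied on the left by `w`. -/
def shiftCode (w : List (Fin n)) (c : Code n k) : Code n k := c.map fun wa => (w ++ wa.1, wa.2)

/-- The translates of `c` by the words with number less than `t`. -/
def shiftCodes (t : ℕ) (c : Code n k) : List (Code n k) :=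
  (List.range t).flatMap fun j => (decode j : Option (List (Fin n))).toList.map (shiftCode · c)

theorem shiftCode_mem_shiftCodes {t : ℕ} {w : List (Fin n)} (c : Code n k) (hw : encode w < t) :
    shiftCode w c ∈ shiftCodes t c := by
  simp only [shiftCodes, List.mem_flatMap, List.mem_range, List.mem_map, Option.mem_toList]
  exact ⟨encode w, hw, w, by simp, rfl⟩

theorem exists_of_mem_shiftCodes {t : ℕ} {c r : Code n k} (hr : r ∈ shiftCodes t c) :
    ∃ w, r = shiftCode w c := by
  simp only [shiftCodes, List.mem_flatMap, List.mem_map] at hr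
  obtain ⟨-, -, w, -, h⟩ := hr
  exact ⟨w, h.symm⟩

theorem shiftCodes_subset {t t' : ℕ} (h : t ≤ t') (c : Code n k) :
    shiftCodes t c ⊆ shiftCodes t' c :=
  fun _ hr =>
    let ⟨j, hj, hjr⟩ := List.mem_flatMap.1 hr
    List.mem_flatMap.2 ⟨j, List.range_subset.2 h hj, hjr⟩

theorem primrec_shiftCodes : Primrec₂ (shiftCodes (n := n) (k := k)) := by
  refine Primrec.list_flatMap (Primrec.list_range.comp Primrec.fst) ?_
  refine Primrec.list_map (Primrec.optionToList.comp (Primrec.decode.comp Primrec.snd)) ?_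
  refine Primrec.list_map (Primrec.snd.comp (Primrec.fst.comp Primrec.fst)) ?_
  exact Primrec.pair
    (Primrec.list_append.comp (Primrec.snd.comp Primrec.fst) (Primrec.fst.comp Primrec.snd))
    (Primrec.snd.comp Primrec.snd)

/-- For some `q ∈ Q`, each list of length `t` that agrees with `q` agrees with one of the codes
in `L` or one of the first translates of `c`. -/
def Verified (Q : List (Code n k)) (L : List (Code n k)) (t : ℕ) (c : Code n k) : Prop :=
  ∃ q ∈ Q, ∀ l ∈ colourings k t, ¬ Matches l q ∨ ∃ r ∈ L ++ shiftCodes t c, Matches l r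

theorem primrecPred_verified (Q : List (Code n k)) :
    PrimrecPred fun p : List (Code n k) × ℕ × Code n k => Verified Q p.1 p.2.1 p.2.2 := by
  have h1 : PrimrecRel fun (l : List (Fin k)) (p : Code n k × List (Code n k)) =>
      ¬ Matches l p.1 ∨ ∃ r ∈ p.2, Matches l r := by
    refine PrimrecPred.or (PrimrecPred.not ?_) ?_
    · exact primrecRel_matches.comp Primrec.fst (Primrec.fst.comp Primrec.snd)
    · have h : PrimrecRel fun (r : Code n k) (l : List (Fin k)) => Matches l r :=
        primrecRel_matches.comp Primrec.snd Primrec.fst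
      exact h.exists_mem_list.comp (Primrec.snd.comp Primrec.snd) Primrec.fst
  have h2 : PrimrecRel fun (q : Code n k) (p : List (Code n k) × ℕ × Code n k) =>
      ∀ l ∈ colourings k p.2.1, ¬ Matches l q ∨ ∃ r ∈ p.1 ++ shiftCodes p.2.1 p.2.2, Matches l r := by
    refine h1.forall_mem_list.comp
      (primrec_colourings.comp (Primrec.fst.comp (Primrec.snd.comp Primrec.snd)))
      (Primrec.pair Primrec.fst (Primrec.list_append.comp (Primrec.fst.comp Primrec.snd) ?_))
    exact primrec_shiftCodes.comp (Primrec.fst.comp (Primrec.snd.comp Primrec.snd))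
      (Primrec.snd.comp (Primrec.snd.comp Primrec.snd))
  exact h2.exists_mem_list.comp (Primrec.const Q) Primrec.id

/-- An enumeration of codes `[(w, a), (w', b)]` with `a ≠ b`, where `w` and `w'` have a common left
inverse; `d` decides which words represent the identity. -/
def clashCodes (k : ℕ) (d : List (Fin n) → Bool) (j : ℕ) : List (Code n k) :=
  ((decode j : Option (List (Fin n) × (List (Fin n) × Fin k) × (List (Fin n) × Fin k))).toList.filter
    fun p => d (p.1 ++ p.2.1.1) && d (p.1 ++ p.2.2.1) && !decide (p.2.1.2 = p.2.2.2)).map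
      fun p => [p.2.1, p.2.2]

theorem mem_clashCodes {d : List (Fin n) → Bool} {r : Code n k} :
    (∃ j, r ∈ clashCodes k d j) ↔ ∃ u w w' a b,
      d (u ++ w) ∧ d (u ++ w') ∧ a ≠ b ∧ r = [(w, a), (w', b)] := by
  simp only [clashCodes, List.mem_map, List.mem_filter, Option.mem_toList, Bool.and_eq_true,
    Bool.not_eq_true', decide_eq_false_iff_not]
  constructor
  · rintro ⟨j, ⟨u, ⟨w, a⟩, w', b⟩, ⟨-, ⟨h1, h2⟩, h3⟩, rfl⟩
    exact ⟨u, w, w', a, b, h1, h2, h3, rfl⟩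
  · rintro ⟨u, w, w', a, b, h1, h2, h3, rfl⟩
    exact ⟨encode (u, (w, a), w', b), (u, (w, a), w', b), ⟨by simp, ⟨h1, h2⟩, h3⟩, rfl⟩

theorem computable_clashCodes {d : List (Fin n) → Bool} (hd : Computable d) :
    Computable (clashCodes k d) := by
  let T := List (Fin n) × (List (Fin n) × Fin k) × (List (Fin n) × Fin k)
  have hb : Computable fun p : T =>
      d (p.1 ++ p.2.1.1) && d (p.1 ++ p.2.2.1) && !decide (p.2.1.2 = p.2.2.2) := by
    have h1 : Computable fun p : T => d (p.1 ++ p.2.1.1) := hd.comp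
      (Primrec.list_append.comp Primrec.fst
        (Primrec.fst.comp (Primrec.fst.comp Primrec.snd))).to_comp
    have h2 : Computable fun p : T => d (p.1 ++ p.2.2.1) := hd.comp
      (Primrec.list_append.comp Primrec.fst
        (Primrec.fst.comp (Primrec.snd.comp Primrec.snd))).to_comp
    have h3 : Computable fun p : T => decide (p.2.1.2 = p.2.2.2) :=
      (Primrec.eq.comp (Primrec.snd.comp (Primrec.fst.comp Primrec.snd))
        (Primrec.snd.comp (Primrec.snd.comp Primrec.snd))).decide.to_comp
    exact Primrec.and.to_comp.comp (Primrec.and.to_comp.comp h1 h2) (Primrec.not.to_comp.comp h3)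
  -- The test is only computable, not primitive recursive. As the filtered list has at most one
  -- entry, a conditional replaces the filter.
  have hs : Computable fun p : T => bif
      d (p.1 ++ p.2.1.1) && d (p.1 ++ p.2.2.1) && !decide (p.2.1.2 = p.2.2.2)
      then [([p.2.1, p.2.2] : Code n k)] else [] := by
    refine Computable.cond hb (Primrec.to_comp ?_) (Computable.const _)
    exact Primrec.list_cons.comp (Primrec.list_cons.comp (Primrec.fst.comp Primrec.snd)
      (Primrec.list_cons.comp (Primrec.snd.comp Primrec.snd) (Primrec.const [])))
      (Primrec.const [])
  refine ((Computable.option_map (Computable.decode (α := T)) (hs.comp Computable.snd).to₂).option_getD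
    (Computable.const [])).of_eq fun j => ?_
  unfold clashCodes
  cases (decode j : Option T) with
  | none => simp
  | some p =>
    simp only [Option.map_some, Option.getD_some, Option.toList_some, List.filter_cons,
      List.filter_nil]
    cases (d (p.1 ++ p.2.1.1) && d (p.1 ++ p.2.2.1) && !decide (p.2.1.2 = p.2.2.2)) <;> simp

end Checks

/-! ### Compactness of the space of colourings of words -/

section Agreement

variable {n k : ℕ}

/-- The colouring `y` of all words agrees with `c`. -/
def Agrees (y : List (Fin n) → Fin k) (c : Code n k) : Prop := ∀ wa ∈ c, y wa.1 = wa.2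

theorem isClopen_agrees (c : Code n k) : IsClopen {y | Agrees y c} := by
  induction c with
  | nil => simp [Agrees, isClopen_univ]
  | cons wa c ih =>
    have h : {y : List (Fin n) → Fin k | Agrees y (wa :: c)} =
        (fun y => y wa.1) ⁻¹' {wa.2} ∩ {y | Agrees y c} := by
      ext y; simp [Agrees]
    rw [h]
    exact ((isClopen_discrete _).preimage (continuous_apply _)).inter ih

/-- The restriction of a colouring of all words to the words with small numbers. -/
def truncate (y : List (Fin n) → Fin k) (t : ℕ) : List (Fin k) :=
  (List.range t).map fun j => y ((decode j).getD [])

theorem truncate_getElem? (y : List (Fin n) → Fin k) (t : ℕ) (w : List (Fin n)) :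
    (truncate y t)[encode w]? = if encode w < t then some (y w) else none := by
  split_ifs with h <;> simp [truncate, h]

theorem Agrees.matches_truncate {y : List (Fin n) → Fin k} {c : Code n k} {t : ℕ}
    (h : Agrees y c) (ht : ∀ wa ∈ c, encode wa.1 < t) : Matches (truncate y t) c := fun wa hwa => by
  rw [truncate_getElem?, if_pos (ht wa hwa), h wa hwa]

/-- No bound on `t` is needed: a lookup out of range returns `none`, so matching already forces the
words of `c` into range. -/
theorem Matches.agrees_of_truncate {y : List (Fin n) → Fin k} {c : Code n k} {t : ℕ}
    (h : Matches (truncate y t) c) : Agrees y c := fun wa hwa => by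
  have := h wa hwa
  rw [truncate_getElem?] at this
  split_ifs at this
  exact Option.some.inj this

theorem eventually_encode_lt (c : Code n k) :
    ∀ᶠ t in Filter.atTop, ∀ wa ∈ c, encode wa.1 < t :=
  (c.finite_toSet.eventually_all (p := fun wa t => encode wa.1 < t)).2
    fun _ _ => Filter.eventually_gt_atTop _

/-- If finite lists of codes together cover the cylinder of `q`, then finitely many of them do, and
this is visible on the colourings of finitely many words. -/
theorem eventually_matches_of_cover {q : Code n k} {r : ℕ → List (Code n k)}
    (h : ∀ y, Agrees y q → ∃ i, ∃ c ∈ r i, Agrees y c) :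
    ∀ᶠ m in Filter.atTop, ∀ l, m ≤ l.length → Matches l q → ∃ i < m, ∃ c ∈ r i, Matches l c := by
  have hopen : ∀ i, IsOpen {y : List (Fin n) → Fin k | ∃ c ∈ r i, Agrees y c} := fun i => by
    have : {y : List (Fin n) → Fin k | ∃ c ∈ r i, Agrees y c} =
        ⋃ c ∈ {c | c ∈ r i}, {y | Agrees y c} := by ext; simp
    rw [this]
    exact isOpen_biUnion fun c _ => (isClopen_agrees c).isOpen
  obtain ⟨T, hT⟩ := (isClopen_agrees q).isClosed.isCompact.elim_finite_subcover _ hopen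
    fun y hy => Set.mem_iUnion.2 (h y hy)
  have hb : ∀ᶠ m in Filter.atTop, ∀ i ∈ T, i < m ∧ ∀ c ∈ r i, ∀ wa ∈ c, encode wa.1 < m := by
    refine (Filter.eventually_all_finset T).2 fun i _ => (Filter.eventually_gt_atTop i).and ?_
    exact ((r i).finite_toSet.eventually_all
      (p := fun c m => ∀ wa ∈ c, encode wa.1 < m)).2 fun c _ => eventually_encode_lt c
  filter_upwards [hb, Filter.eventually_gt_atTop 0] with m hm hm0 l hl hq
  have hl0 : 0 < l.length := hm0.trans_le hl
  -- Any extension of `l` to all words works; `m > 0` provides the filler letter `l[0]`.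
  let y : List (Fin n) → Fin k := fun w => l.getD (encode w) l[0]
  have hy : Agrees y q := fun wa hwa => by simp [y, List.getD, hq wa hwa]
  obtain ⟨i, hi, c, hc, hyc⟩ : ∃ i ∈ T, ∃ c ∈ r i, Agrees y c := by simpa using hT hy
  refine ⟨i, (hm i hi).1, c, hc, fun wa hwa => ?_⟩
  have hlt : encode wa.1 < l.length := ((hm i hi).2 c hc wa hwa).trans_le hl
  have := hyc wa hwa
  simp only [y, List.getD, List.getElem?_eq_getElem hlt, Option.getD_some] at this
  rw [List.getElem?_eq_getElem hlt, this]

end Agreement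

/-! ### Configurations as colourings of words -/

section Lift

variable {G A : Type*} [Group G] {n k : ℕ} {s : Fin n → G} {e : A ≃ Fin k}

/-- The colouring of the words that is induced by a configuration. -/
def lift (s : Fin n → G) (e : A ≃ Fin k) (x : G → A) (w : List (Fin n)) : Fin k :=
  e (x (wordEval s w))

theorem wordEval_append (v w : List (Fin n)) :
    wordEval s (v ++ w) = wordEval s v * wordEval s w := by
  simp [wordEval]

theorem agrees_lift_shiftCode {x : G → A} {w : List (Fin n)} {c : Code n k} :
    Agrees (lift s e x) (shiftCode w c) ↔
      Agrees (lift s e (SymbolicDynamics.FullShift.mulShift (wordEval s w) x)) c := by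
  simp only [Agrees, shiftCode, List.forall_mem_map, lift, wordEval_append]
  rfl

theorem mem_codes_of_agrees {L : Set (Pattern G A)} {x : G → A} {c : Code n k}
    (h : Agrees (lift s e x) c)
    (hL : ∀ p : Pattern G A, (∀ g : p.support, x g = p.val g) → Represents s e c p → p ∈ L) :
    c ∈ codes s e L := by
  classical
  let p : Pattern G A := ⟨(c.map fun wa => wordEval s wa.1).toFinset, fun g => x g⟩
  have hp : Represents s e c p := by
    refine ⟨fun wa hwa => ⟨?_, ?_⟩, fun g hg => ?_⟩
    · exact List.mem_toFinset.2 (List.mem_map.2 ⟨wa, hwa, rfl⟩)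
    · exact e.eq_symm_apply.2 (h wa hwa)
    · simpa only [List.mem_map] using List.mem_toFinset.1 hg
  exact ⟨p, hL p (fun _ => rfl) hp, hp⟩

theorem Represents.forall_eq_iff {x : G → A} {c : Code n k} {p : Pattern G A}
    (hp : Represents s e c p) : (∀ g : p.support, x g = p.val g) ↔ Agrees (lift s e x) c := by
  constructor
  · intro h wa hwa
    obtain ⟨hg, hv⟩ := hp.1 wa hwa
    rw [lift, h ⟨_, hg⟩, hv, e.apply_symm_apply]
  · rintro h ⟨g, hg⟩
    obtain ⟨wa, hwa, rfl⟩ := hp.2 g hg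
    obtain ⟨hg', hv⟩ := hp.1 wa hwa
    exact (e.eq_symm_apply.2 (h wa hwa)).trans hv.symm

theorem mem_codes_language_iff {X : Set (G → A)} {c : Code n k} :
    c ∈ codes s e (language X) ↔ ∃ x ∈ X, Agrees (lift s e x) c := by
  constructor
  · rintro ⟨p, ⟨x, hx, hxp⟩, hp⟩
    exact ⟨x, hx, hp.forall_eq_iff.1 hxp⟩
  · rintro ⟨x, hx, h⟩
    exact mem_codes_of_agrees h fun p hp _ => ⟨x, hx, hp⟩

theorem not_agrees_of_mem_codes_compl {X : Set (G → A)} {c : Code n k}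
    (hc : c ∈ codes s e (language X)ᶜ) {x : G → A} (hx : x ∈ X) : ¬ Agrees (lift s e x) c := by
  obtain ⟨p, hpX, hp⟩ := hc
  exact fun h => hpX ⟨x, hx, hp.forall_eq_iff.2 h⟩

/-- The point `x`, which need not lie in `X`, ensures that `c` is consistent: an inconsistent code
describes no pattern, hence is not enumerated as forbidden. -/
theorem mem_codes_compl_of_forall_not_agrees {X : Set (G → A)} {c : Code n k} {x : G → A}
    (h : Agrees (lift s e x) c) (hX : ∀ y ∈ X, ¬ Agrees (lift s e y) c) :
    c ∈ codes s e (language X)ᶜ :=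
  mem_codes_of_agrees h fun _ _ hp ⟨y, hy, hyp⟩ => hX y hy (hp.forall_eq_iff.1 hyp)

variable [TopologicalSpace A]

/-- A basic neighbourhood of `x` missing `X` constrains finitely many coordinates; the code records
`x` there. -/
theorem exists_code_of_notMem (hgen : IsGenerating s) (e : A ≃ Fin k) {X : Set (G → A)}
    (hX : IsClosed X) {x : G → A} (hx : x ∉ X) :
    ∃ c : Code n k, Agrees (lift s e x) c ∧ ∀ y ∈ X, ¬ Agrees (lift s e y) c := by
  choose word hword using hgen
  obtain ⟨I, u, hu, hIu⟩ := isOpen_pi_iff.1 hX.isOpen_compl x hx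
  refine ⟨I.toList.map fun g => (word g, e (x g)), ?_, fun y hy h => hIu (fun g hg => ?_) hy⟩
  · simp [Agrees, lift, hword]
  · have : y g = x g := by
      have := h (word g, e (x g)) (List.mem_map.2 ⟨g, by simpa using hg, rfl⟩)
      simpa [lift, hword] using this
    rw [this]
    exact (hu g hg).2

/-- In a quasi-minimal shift, finitely many patterns suffice to recognize proper subshifts. -/
theorem QuasiMinimal.exists_testCodes {X : MulSubshift A G} (hX : QuasiMinimal X)
    (hgen : IsGenerating s) (e : A ≃ Fin k) :
    ∃ Q : List (Code n k), (∀ q ∈ Q, ∃ x ∈ X.carrier, Agrees (lift s e x) q) ∧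
      ∀ Y : MulSubshift A G, Y.carrier ⊂ X.carrier →
        ∃ q ∈ Q, ∀ y ∈ Y.carrier, ¬ Agrees (lift s e y) q := by
  have h : ∀ Y : MulSubshift A G, Y.carrier ⊂ X.carrier → ∃ q : Code n k,
      (∃ x ∈ X.carrier, Agrees (lift s e x) q) ∧
        ∀ y ∈ Y.carrier, ¬ Agrees (lift s e y) q := fun Y hY => by
    obtain ⟨x, hx, hxY⟩ := Set.exists_of_ssubset hY
    obtain ⟨q, hq, hqY⟩ := exists_code_of_notMem hgen e Y.isClosed hxY
    exact ⟨q, ⟨x, hx, hq⟩, hqY⟩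
  choose! q hq hqY using h
  have hfin : {Y : MulSubshift A G | Y.carrier ⊂ X.carrier}.Finite :=
    hX.subset fun Y (hY : Y.carrier ⊂ X.carrier) => hY.subset
  refine ⟨hfin.toFinset.toList.map q, ?_, fun Y hY => ⟨q Y, ?_, hqY Y hY⟩⟩
  · simpa using hq
  · exact List.mem_map.2 ⟨Y, by simpa using hY, rfl⟩

variable [DiscreteTopology A]

theorem continuous_lift : Continuous (lift s e) :=
  continuous_pi fun _ => continuous_of_discreteTopology.comp (continuous_apply _)

/-- The subshift of the configurations in which no translate of `c` occurs. -/
def avoiding (s : Fin n → G) (e : A ≃ Fin k) (X : MulSubshift A G) (c : Code n k) :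
    MulSubshift A G where
  carrier := X.carrier ∩
    ⋂ g, {x | ¬ Agrees (lift s e (SymbolicDynamics.FullShift.mulShift g x)) c}
  isClosed := X.isClosed.inter <| isClosed_iInter fun g =>
    ((isClopen_agrees c).compl.isClosed.preimage continuous_lift).preimage
      (SymbolicDynamics.FullShift.continuous_mulShift g)
  mapsTo g x hx := by
    refine ⟨X.mapsTo g hx.1, Set.mem_iInter.2 fun h => ?_⟩
    have := Set.mem_iInter.1 hx.2 (g * h)
    rwa [Set.mem_ofPred_eq, SymbolicDynamics.FullShift.mulShift_mul] at this

end Lift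

end GShift

/-! ### The semi-decision procedure -/

theorem mainTheorem8 {G : Type*} [Group G] {n : ℕ} (s : Fin n → G)
    (hgen : GShift.IsGenerating s) (hword : GShift.DecidableWordProblem s)
    {A : Type*} [TopologicalSpace A] [DiscreteTopology A] {k : ℕ} (e : A ≃ Fin k)
    (X : MulSubshift A G) (hX : GShift.QuasiMinimal X) :
    GShift.StrongComputableType s e X := by
  open GShift Encodable in
  rintro O ⟨f, hf, hfX⟩
  refine ⟨?_, f, hf, hfX⟩
  obtain ⟨d, hd, hdw⟩ := ComputablePred.computable_iff.1 hword
  replace hdw : ∀ w, wordEval s w = 1 ↔ d w := fun w => iff_of_eq (congrFun hdw w)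
  obtain ⟨Q, hQX, hQ⟩ := hX.exists_testCodes hgen e
  -- Colourings of length at least `M` see every word of every test code. On shorter ones a test
  -- code might match nothing, making `Verified` vacuously true.
  obtain ⟨M, hM⟩ : ∃ M, ∀ q ∈ Q, ∀ wa ∈ q, encode wa.1 < M :=
    ((Q.finite_toSet.eventually_all (p := fun q m => ∀ wa ∈ q, encode wa.1 < m)).2
      fun q _ => eventually_encode_lt q).exists
  let f' : ℕ → List (Code n k) := fun m => (f m).toList ++ clashCodes k d m
  have hf' : ComputableIn {oracleFun O} f' :=
    Computable.comp_computableIn (F := fun m o => o.toList ++ clashCodes k d m)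
      (Primrec.list_append.to_comp.comp (Primrec.optionToList.to_comp.comp Computable.snd)
        ((computable_clashCodes hd).comp Computable.fst)) hf
  classical
  -- The number `m` names the candidate `c` by its first component and itself serves as the search
  -- bound.
  let F : ℕ → List (List (Code n k)) → Option (Code n k) := fun m L =>
    (decode m.unpair.1).bind fun c => if Verified Q L.flatten (m + M) c then some c else none
  have hF : Computable₂ F := by
    refine Primrec.to_comp (Primrec.option_bind (Primrec.decode.comp
      (Primrec.fst.comp (Primrec.unpair.comp Primrec.fst))) (Primrec.ite ?_
        (Primrec.option_some.comp Primrec.snd) (Primrec.const none)))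
    exact (primrecPred_verified Q).comp (Primrec.pair
      (Primrec.list_flatten.comp (Primrec.snd.comp Primrec.fst)) (Primrec.pair
        (Primrec.nat_add.comp (Primrec.fst.comp Primrec.fst) (Primrec.const M)) Primrec.snd))
  refine ⟨fun m => F m ((List.range m).map f'),
    Computable.comp_computableIn hF hf'.map_range, fun c => ?_⟩
  have hL : ∀ m r, r ∈ ((List.range m).map f').flatten ↔ ∃ i < m, r ∈ f' i := by simp
  rw [mem_codes_language_iff]
  constructor
  · rintro ⟨x, hx, hxc⟩
    have hproper : (avoiding s e X c).carrier ⊂ X.carrier :=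
      Set.inter_subset_left.ssubset_of_ne fun h => by
        have := Set.mem_iInter.1 (h.symm.subset hx).2 1
        rw [Set.mem_ofPred_eq, SymbolicDynamics.FullShift.mulShift_one] at this
        exact this hxc
    obtain ⟨q, hqQ, hq⟩ := hQ _ hproper
    have hcover : ∀ y, Agrees y q → ∃ i, ∃ r ∈ f' i ++ shiftCodes (i + 1) c, Agrees y r := by
      intro y hy
      by_cases hcons : ∀ w w', wordEval s w = wordEval s w' → y w = y w'
      · choose word hword using hgen
        obtain ⟨x, rfl⟩ : ∃ x, lift s e x = y :=
          ⟨fun g => e.symm (y (word g)), funext fun w => by simp [lift, hcons _ _ (hword _)]⟩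
        by_cases hxX : x ∈ X.carrier
        · have hxa : ¬ ∀ g, ¬ Agrees (lift s e (SymbolicDynamics.FullShift.mulShift g x)) c :=
            fun h => hq x ⟨hxX, Set.mem_iInter.2 h⟩ hy
          push Not at hxa
          obtain ⟨g, hg⟩ := hxa
          rw [← hword g, ← agrees_lift_shiftCode] at hg
          exact ⟨encode (word g), _, List.mem_append_right _
            (shiftCode_mem_shiftCodes c (Nat.lt_succ_self _)), hg⟩
        · obtain ⟨r, hr, hrX⟩ := exists_code_of_notMem (fun g => ⟨word g, hword g⟩) e X.isClosed hxX
          obtain ⟨i, hi⟩ := (hfX r).1 (mem_codes_compl_of_forall_not_agrees hr hrX)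
          exact ⟨i, r, by simp [f', hi], hr⟩
      · push Not at hcons
        obtain ⟨w, w', hww, hne⟩ := hcons
        -- A word for the inverse certifies the equality of `w` and `w'` in `G` using only tests for
        -- the identity.
        obtain ⟨u, hu⟩ := hgen (wordEval s w)⁻¹
        obtain ⟨i, hi⟩ := mem_clashCodes.2 ⟨u, w, w', y w, y w',
          (hdw _).1 (by simp [wordEval_append, hu]),
          (hdw _).1 (by simp [wordEval_append, hu, hww]), hne, rfl⟩
        exact ⟨i, _, List.mem_append_left _ (List.mem_append_right _ hi), by simp [Agrees]⟩
    obtain ⟨N, hN⟩ := Filter.eventually_atTop.1 (eventually_matches_of_cover hcover)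
    -- The second component only makes the stage at least `N`.
    refine ⟨Nat.pair (encode c) N, ?_⟩
    have hv : Verified Q ((List.range (Nat.pair (encode c) N)).map f').flatten
        (Nat.pair (encode c) N + M) c := by
      refine ⟨q, hqQ, fun l hl => or_iff_not_imp_left.2 fun hlq => ?_⟩
      obtain ⟨i, hi, r, hr, hlr⟩ := hN _ (Nat.right_le_pair _ _) l
        ((Nat.le_add_right _ M).trans_eq (mem_colourings.1 hl).symm) (not_not.1 hlq)
      refine ⟨r, ?_, hlr⟩
      rcases List.mem_append.1 hr with hr | hr
      · exact List.mem_append_left _ ((hL _ _).2 ⟨i, hi, hr⟩)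
      · exact List.mem_append_right _ (shiftCodes_subset (by omega) c hr)
    simp [F, hv]
  · rintro ⟨m, hm⟩
    obtain ⟨c', -, hc'⟩ := Option.bind_eq_some_iff.1 hm
    split_ifs at hc' with hv
    obtain rfl := Option.some.inj hc'
    obtain ⟨q, hqQ, hq⟩ := hv
    -- Soundness: this `x` agrees with `q`, and neither forbidden codes nor clashes can agree with
    -- it, so a translate of `c` must.
    obtain ⟨x, hx, hxq⟩ := hQX q hqQ
    have hlq : Matches (truncate (lift s e x) (m + M)) q :=
      hxq.matches_truncate fun wa hwa => (hM q hqQ wa hwa).trans_le (Nat.le_add_left _ _)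
    obtain ⟨r, hr, hlr⟩ := (hq _ (mem_colourings.2 (by simp [truncate]))).resolve_left
      (not_not.2 hlq)
    have hxr := hlr.agrees_of_truncate
    rcases List.mem_append.1 hr with hr | hr
    · obtain ⟨i, -, hi⟩ := (hL _ _).1 hr
      rcases List.mem_append.1 hi with hi | hi
      · exact absurd hxr (not_agrees_of_mem_codes_compl ((hfX r).2 ⟨i, by simpa using hi⟩) hx)
      · obtain ⟨u, w, w', a, b, h1, h2, hne, rfl⟩ := mem_clashCodes.1 ⟨i, hi⟩
        rw [← hdw, wordEval_append] at h1 h2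
        have hww : wordEval s w = wordEval s w' := mul_left_cancel (h1.trans h2.symm)
        have ha : lift s e x w = a := hxr (w, a) (by simp)
        have hb : lift s e x w' = b := hxr (w', b) (by simp)
        exact absurd (by rw [← ha, ← hb, lift, lift, hww]) hne
    · obtain ⟨w, rfl⟩ := exists_of_mem_shiftCodes hr
      exact ⟨_, X.mapsTo _ hx, agrees_lift_shiftCode.1 hxr⟩
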